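/- **Theorem 3.13.** Let $D$ be a Krull domain whose divisor class group $\operatorname{Cl}(D)$ is cyclic of finite order $n\ge 1$, and suppose that there is a height-1 prime ideal $\mathfrak p$ of $D$ whose class $[\mathfrak p]$ generates $\operatorname{Cl}(D)$ (written additively). Set $$S=\{s\in\mathbb Z \mid 1\le s\le n \text{ and } s\,[\mathfrak p]=[\mathfrak q]\text{ in }\operatorname{Cl}(D)\text{ for some height-1 prime ideal }\mathfrak q\text{ of }D\},$$ and assume that $S$ is totally ordered by divisibility, i.e. for all $s,t\in S$ either $s\mid t$ or $t\mid s$. If $D$ is a half-factorial domain (HFD), then $D$ is an irreducible divisor pair domain (IDPD). Here an integral domain is *atomic* if every nonzero nonunit is a finite product of irreducible elements (atoms). An *HFD* is an atomic domain such that $p_1\cdots p_m=q_1\cdots q_k$ with all $p_i,q_j$ atoms implies $m=k$. An *IDPD* is an atomic domain $D$ such that for every nonzero nonunit $z\in D$ and all non-associate irreducible divisors $p,q$ of $z$ there exist atoms $p',q'\in D$ such that $pp'$ and $qq'$ are associates and divide $z$. -/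

import Mathlib

noncomputable section

/-- A domain is atomic if every nonzero nonunit is a finite product of irreducible elements. -/
def IsAtomicDomain (D : Type*) [CommRing D] [IsDomain D] : Prop :=
  ∀ z : D, z ≠ 0 → ¬ IsUnit z →
    ∃ s : Multiset D, (∀ p ∈ s, Irreducible p) ∧ s.prod = z

/-- Half-factorial domain: atomic, and any two factorizations of the same element into
irreducible elements have the same length. -/
def IsHFD (D : Type*) [CommRing D] [IsDomain D] : Prop :=
  IsAtomicDomain D ∧
    ∀ s t : Multiset D, (∀ p ∈ s, Irreducible p) → (∀ q ∈ t, Irreducible q) →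
      s.prod = t.prod → s.card = t.card

/-- Irreducible divisor pair domain: atomic, and for every nonzero nonunit `z` and all
nonassociate irreducible divisors `p, q` of `z` there are irreducible `p', q'` such that
`p * p'` and `q * q'` are associates dividing `z`. -/
def IsIDPD (D : Type*) [CommRing D] [IsDomain D] : Prop :=
  IsAtomicDomain D ∧
    ∀ z : D, z ≠ 0 → ¬ IsUnit z →
      ∀ p q : D, Irreducible p → Irreducible q → p ∣ z → q ∣ z → ¬ Associated p q →
        ∃ p' q' : D, Irreducible p' ∧ Irreducible q' ∧
          Associated (p * p') (q * q') ∧ q * q' ∣ z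

/-- The prime ideals of height one. -/
abbrev HeightOnePrime (D : Type*) [CommRing D] : Type _ :=
  {p : PrimeSpectrum D // p.asIdeal.height = 1}

/-- A Krull domain: the localizations at the height-one primes are discrete valuation rings,
`D` is the intersection of these localizations inside its field of fractions, and every nonzero
element lies in only finitely many height-one primes. -/
class IsKrullDomain (D : Type*) [CommRing D] [IsDomain D] : Prop where
  isDiscreteValuationRing : ∀ p : HeightOnePrime D,
    IsDiscreteValuationRing (Localization.AtPrime p.1.asIdeal)
  iInf_localization_eq_bot :
    (⨅ p : HeightOnePrime D, Localization.subalgebra.ofField (FractionRing D) _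
      p.1.asIdeal.primeCompl_le_nonZeroDivisors) = ⊥
  finite_setOf_mem : ∀ a : D, a ≠ 0 → {p : HeightOnePrime D | a ∈ p.1.asIdeal}.Finite

attribute [instance] IsKrullDomain.isDiscreteValuationRing

section Krull

variable (D : Type*) [CommRing D] [IsDomain D]

/-- The group of divisors: the free abelian group on the height-one primes. The divisor
`∑ e_p • p` stands for the divisorial fractional ideal `⋂ p^(e_p)`. -/
abbrev KrullDivisor : Type _ := HeightOnePrime D →₀ ℤ

variable {D} [IsKrullDomain D]

/-- The value of `a` under the normalized valuation of `D` localized at `p`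
(junk value `0` at `a = 0`). -/
def ordAt (p : HeightOnePrime D) (a : D) : ℕ :=
  (IsDiscreteValuationRing.addVal (Localization.AtPrime p.1.asIdeal)
    (algebraMap D (Localization.AtPrime p.1.asIdeal) a)).toNat

theorem ordAt_eq_zero_of_notMem (p : HeightOnePrime D) (a : D) (ha : a ∉ p.1.asIdeal) :
    ordAt p a = 0 := by
  have hu : IsUnit (algebraMap D (Localization.AtPrime p.1.asIdeal) a) :=
    IsLocalization.map_units (M := p.1.asIdeal.primeCompl) _ ⟨a, ha⟩
  simp [ordAt, IsDiscreteValuationRing.addVal_eq_zero_iff.mpr hu]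

/-- The divisor `∑ ord_p(a) • p` of a nonzero element `a` of `D`. -/
def elementDivisor (a : D) (ha : a ≠ 0) : KrullDivisor D :=
  Finsupp.ofSupportFinite (fun p => (ordAt p a : ℤ))
    ((IsKrullDomain.finite_setOf_mem a ha).subset (by
      intro p hp
      by_contra h
      exact hp (by simp [ordAt_eq_zero_of_notMem p a h])))

variable (D)

/-- The group of principal divisors. Since `div (a / b) = div a - div b`, the divisors of the
nonzero elements of the field of fractions are generated by those of nonzero elements of `D`. -/
def principalDivisors : AddSubgroup (KrullDivisor D) :=
  AddSubgroup.closure {d | ∃ (a : D) (ha : a ≠ 0), d = elementDivisor a ha}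

/-- The divisor class group `Cl(D)`, written additively: divisors modulo principal divisors. -/
abbrev DivisorClassGroup : Type _ := KrullDivisor D ⧸ principalDivisors D

variable {D}

/-- The class of a height-one prime in the divisor class group. -/
def primeClass (p : HeightOnePrime D) : DivisorClassGroup D :=
  QuotientAddGroup.mk (Finsupp.single p 1)

/-- For a height-one prime `p` whose class generates the finite group `Cl(D)` of order `n`: the
integers `1 ≤ s ≤ n` such that `s` times the class of `p` is the class of a height-one prime. -/
def primeClassExponents (p : HeightOnePrime D) : Set ℤ :=
  {s | 1 ≤ s ∧ s ≤ (Nat.card (DivisorClassGroup D) : ℤ) ∧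
    ∃ q : HeightOnePrime D, s • primeClass p = primeClass q}

end Krull

end

/-!
Let `n` be the order of the class group. Each height-one prime `q` gets a weight `s q ∈ [1, n]`
with `s q • [p] = [q]`, and the weight of a divisor is the corresponding linear combination
`Finsupp.linearCombination ℤ s`. Since `[p]` has order `n`, a divisor is principal if and only if
`n` divides its weight (`mem_principalDivisors_iff_dvd_linearCombination`). In a Krull domain
divisibility of elements is the order of their divisors (`dvd_of_elementDivisor_le`), so the theorem
becomes a statement about effective divisors and their weights.

Half-factoriality makes every `s q` a divisor of `n` (`dvd_of_isHFD`). Because the weights also form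
a chain under divisibility, every effective divisor of weight at least `n` contains one of weight
exactly `n` (`exists_le_linearCombination_eq`): discard points of smallest weight until the weight
is `n`; no step jumps over `n`, as the smallest weight divides both `n` and the total. Hence the
atoms are the elements of weight `n`.

For nonassociate atoms `a, b` dividing `z`, with divisors `P ≠ Q` below `Z`, it therefore suffices
to find a divisor `W` of weight `2 * n` with `P ⊔ Q ≤ W ≤ Z`: an element `y` with divisor `W` is
`a * a' = b * b'` with `a', b'` of weight `n`. The divisor `P ⊔ Q` has weight `2 * n - g`, where
`g` is the weight of `P ⊓ Q`, and `0 ≤ g < n`. The weight of `Z - P ⊔ Q` is congruent to `g` modulo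
`n`, so removing parts of weight `n` from it leaves a part of weight exactly `g` to be added
to `P ⊔ Q` (`exists_sup_le_linearCombination_eq`).
-/

/-! ### Weights of effective divisors -/

section Weight

variable {ι : Type*} {s : ι → ℤ}

theorem linearCombination_nonneg_of_pos (hs : ∀ i, 0 < s i) {T : ι →₀ ℤ} (hT : 0 ≤ T) :
    0 ≤ Finsupp.linearCombination ℤ s T := by
  rw [Finsupp.linearCombination_apply]
  exact Finset.sum_nonneg fun i _ => mul_nonneg (hT i) (hs i).le

theorem linearCombination_le_of_pos (hs : ∀ i, 0 < s i) {T U : ι →₀ ℤ} (h : T ≤ U) :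
    Finsupp.linearCombination ℤ s T ≤ Finsupp.linearCombination ℤ s U := by
  have := linearCombination_nonneg_of_pos hs (sub_nonneg.mpr h)
  rw [map_sub] at this
  linarith

theorem eq_of_le_of_linearCombination_eq (hs : ∀ i, 0 < s i) {T U : ι →₀ ℤ} (h : T ≤ U)
    (hw : Finsupp.linearCombination ℤ s T = Finsupp.linearCombination ℤ s U) : T = U := by
  have h0 : Finsupp.linearCombination ℤ s (U - T) = 0 := by rw [map_sub, hw, sub_self]
  have hUT : 0 ≤ U - T := sub_nonneg.mpr h
  simp only [Finsupp.linearCombination_apply, Finsupp.sum, smul_eq_mul] at h0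
  rw [Finset.sum_eq_zero_iff_of_nonneg fun i _ => mul_nonneg (hUT i) (hs i).le] at h0
  ext i
  by_contra hne
  have hi : (U - T) i ≠ 0 := by
    rw [Finsupp.sub_apply]
    exact fun h => hne (by linarith)
  exact mul_ne_zero hi (hs i).ne' (h0 i (Finsupp.mem_support_iff.mpr hi))

/-- If the weights form a divisibility chain of divisors of `n`, an effective divisor of weight at
least `n` has an effective part of weight exactly `n`. -/
theorem exists_le_linearCombination_eq (hs : ∀ i, 0 < s i) (hchain : ∀ i j, s i ∣ s j ∨ s j ∣ s i)
    {n : ℤ} (hn : 0 < n) (hdvd : ∀ i, s i ∣ n) {T : ι →₀ ℤ} (hT : 0 ≤ T)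
    (hTn : n ≤ Finsupp.linearCombination ℤ s T) :
    ∃ U, 0 ≤ U ∧ U ≤ T ∧ Finsupp.linearCombination ℤ s U = n := by
  obtain ⟨k, hk⟩ := Int.eq_ofNat_of_zero_le (sub_nonneg.mpr hTn)
  induction k using Nat.strong_induction_on generalizing T with
  | _ k ih =>
    rcases hTn.eq_or_lt with heq | hlt
    · exact ⟨T, hT, le_rfl, heq.symm⟩
    have hne : T.support.Nonempty := by
      rw [Finsupp.support_nonempty_iff]
      rintro rfl
      simp only [map_zero] at hTn
      linarith
    -- The smallest weight `s i` in the support divides all the others, hence also the excess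
    -- over `n`; so removing the point `i` does not bring the total below `n`.
    obtain ⟨i, hi, hmin⟩ := T.support.exists_min_image s hne
    have hall : ∀ j ∈ T.support, s i ∣ s j := by
      intro j hj
      rcases hchain i j with h | h
      · exact h
      · rw [le_antisymm (hmin j hj) (Int.le_of_dvd (hs i) h)]
    have hTi : s i ∣ Finsupp.linearCombination ℤ s T := by
      rw [Finsupp.linearCombination_apply]
      exact Finset.dvd_sum fun j hj => Dvd.dvd.mul_left (hall j hj) _
    have hle : s i ≤ Finsupp.linearCombination ℤ s T - n :=
      Int.le_of_dvd (sub_pos.mpr hlt) (dvd_sub hTi (hdvd i))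
    have hTi1 : 1 ≤ T i :=
      lt_of_le_of_ne (hT i) (Finsupp.mem_support_iff.mp hi).symm
    have hsingle : Finsupp.single i 1 ≤ T := by
      classical
      intro j
      rw [Finsupp.single_apply]
      split_ifs with h
      · exact h ▸ hTi1
      · exact hT j
    have hw : Finsupp.linearCombination ℤ s (T - Finsupp.single i 1) =
        Finsupp.linearCombination ℤ s T - s i := by
      rw [map_sub, Finsupp.linearCombination_single, one_smul]
    have hsi := hs i
    obtain ⟨U, hU0, hU, hUn⟩ := ih (k - (s i).toNat) (by omega)
      (T := T - Finsupp.single i 1) (sub_nonneg.mpr hsingle) (by rw [hw]; linarith)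
      (by rw [hw]; omega)
    refine ⟨U, hU0, hU.trans (sub_le_self _ ?_), hUn⟩
    exact Finsupp.single_nonneg.mpr zero_le_one

/-- The part of weight `g` is what is left after removing `k` parts of weight `n`. Unlike `n`, the
number `g` need not be divisible by the weights, so it cannot be built up directly. -/
theorem exists_le_linearCombination_eq_of_add_mul (hs : ∀ i, 0 < s i)
    (hchain : ∀ i j, s i ∣ s j ∨ s j ∣ s i) {n : ℤ} (hn : 0 < n) (hdvd : ∀ i, s i ∣ n)
    {g : ℤ} (hg : 0 ≤ g) (k : ℕ) {T : ι →₀ ℤ} (hT : 0 ≤ T)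
    (hTw : Finsupp.linearCombination ℤ s T = g + k * n) :
    ∃ U, 0 ≤ U ∧ U ≤ T ∧ Finsupp.linearCombination ℤ s U = g := by
  induction k generalizing T with
  | zero => exact ⟨T, hT, le_rfl, by simpa using hTw⟩
  | succ k ih =>
    push_cast at hTw
    have hkn : 0 ≤ (k : ℤ) * n := by positivity
    obtain ⟨V, hV0, hV, hVn⟩ := exists_le_linearCombination_eq hs hchain hn hdvd hT (by linarith)
    obtain ⟨U, hU0, hU, hUg⟩ := ih (T := T - V) (sub_nonneg.mpr hV)
      (by rw [map_sub, hTw, hVn]; ring)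
    exact ⟨U, hU0, hU.trans (sub_le_self _ hV0), hUg⟩

/-- Two distinct divisors `P, Q ≤ Z` of weight `n` lie below a divisor `W ≤ Z` of weight `2 * n`,
provided that `n` divides the weight of `Z`: the missing weight, that of `P ⊓ Q`, is what remains
of `Z - P ⊔ Q` after repeatedly removing parts of weight `n`. -/
theorem exists_sup_le_linearCombination_eq (hs : ∀ i, 0 < s i)
    (hchain : ∀ i j, s i ∣ s j ∨ s j ∣ s i) {n : ℤ} (hn : 0 < n) (hdvd : ∀ i, s i ∣ n)
    {P Q Z : ι →₀ ℤ} (hP0 : 0 ≤ P) (hQ0 : 0 ≤ Q) (hP : P ≤ Z) (hQ : Q ≤ Z) (hPQ : P ≠ Q)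
    (hPn : Finsupp.linearCombination ℤ s P = n) (hQn : Finsupp.linearCombination ℤ s Q = n)
    (hZ : n ∣ Finsupp.linearCombination ℤ s Z) :
    ∃ W, P ≤ W ∧ Q ≤ W ∧ W ≤ Z ∧ Finsupp.linearCombination ℤ s W = 2 * n := by
  have hsum : Finsupp.linearCombination ℤ s (P ⊓ Q) + Finsupp.linearCombination ℤ s (P ⊔ Q) =
      2 * n := by
    rw [← map_add, inf_add_sup, map_add, hPn, hQn, two_mul]
  have hg0 := linearCombination_nonneg_of_pos hs (le_inf hP0 hQ0)
  have hgn : Finsupp.linearCombination ℤ s (P ⊓ Q) < n := by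
    refine lt_of_le_of_ne (hPn ▸ linearCombination_le_of_pos hs inf_le_left) fun h => hPQ ?_
    rw [← eq_of_le_of_linearCombination_eq hs inf_le_left (h.trans hPn.symm),
      eq_of_le_of_linearCombination_eq hs (inf_le_right : P ⊓ Q ≤ Q) (h.trans hQn.symm)]
  obtain ⟨j, hj⟩ := hZ
  have hT0 : 0 ≤ Z - P ⊔ Q := sub_nonneg.mpr (sup_le hP hQ)
  have hTw : Finsupp.linearCombination ℤ s (Z - P ⊔ Q) =
      Finsupp.linearCombination ℤ s (P ⊓ Q) + (j - 2) * n := by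
    rw [map_sub, hj]
    linarith
  have hT := linearCombination_nonneg_of_pos hs hT0
  have hj2 : 0 ≤ j - 2 := by
    by_contra h
    nlinarith
  obtain ⟨k, hk⟩ := Int.eq_ofNat_of_zero_le hj2
  obtain ⟨U, hU0, hU, hUg⟩ := exists_le_linearCombination_eq_of_add_mul hs hchain hn hdvd hg0 k
    hT0 (by rw [hTw, hk])
  refine ⟨P ⊔ Q + U, le_add_of_le_of_nonneg le_sup_left hU0,
    le_add_of_le_of_nonneg le_sup_right hU0, ?_, ?_⟩
  · rw [add_comm]
    exact le_sub_iff_add_le.mp hU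
  · rw [map_add, hUg]
    linarith

end Weight

/-! ### Divisors of elements of a Krull domain -/

section Divisors

variable {D : Type*} [CommRing D] [IsDomain D] [IsKrullDomain D]

theorem addVal_algebraMap_ne_top (q : HeightOnePrime D) {a : D} (ha : a ≠ 0) :
    IsDiscreteValuationRing.addVal (Localization.AtPrime q.1.asIdeal)
      (algebraMap D (Localization.AtPrime q.1.asIdeal) a) ≠ ⊤ := by
  rw [Ne, IsDiscreteValuationRing.addVal_eq_top_iff]
  exact fun h => ha (IsLocalization.injective _ q.1.asIdeal.primeCompl_le_nonZeroDivisors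
    (h.trans (map_zero _).symm))

theorem ordAt_mul (q : HeightOnePrime D) {a b : D} (ha : a ≠ 0) (hb : b ≠ 0) :
    ordAt q (a * b) = ordAt q a + ordAt q b := by
  rw [ordAt, map_mul, IsDiscreteValuationRing.addVal_mul,
    ENat.toNat_add (addVal_algebraMap_ne_top q ha) (addVal_algebraMap_ne_top q hb)]
  rfl

theorem elementDivisor_apply (a : D) (ha : a ≠ 0) (q : HeightOnePrime D) :
    elementDivisor a ha q = ordAt q a := rfl

theorem elementDivisor_nonneg (a : D) (ha : a ≠ 0) : 0 ≤ elementDivisor a ha :=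
  fun _ => Nat.cast_nonneg _

theorem elementDivisor_mul {a b : D} (ha : a ≠ 0) (hb : b ≠ 0) :
    elementDivisor (a * b) (mul_ne_zero ha hb) = elementDivisor a ha + elementDivisor b hb := by
  ext q
  simp [elementDivisor_apply, ordAt_mul q ha hb]

theorem elementDivisor_one : elementDivisor (1 : D) one_ne_zero = 0 := by
  have h := elementDivisor_mul (one_ne_zero (α := D)) (one_ne_zero (α := D))
  simp only [mul_one] at h
  exact left_eq_add.mp h

theorem elementDivisor_pow {a : D} (ha : a ≠ 0) (k : ℕ) :
    elementDivisor (a ^ k) (pow_ne_zero k ha) = k • elementDivisor a ha := by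
  induction k with
  | zero => simpa using elementDivisor_one
  | succ k ih =>
    simp only [pow_succ, succ_nsmul]
    rw [elementDivisor_mul (pow_ne_zero k ha) ha, ih]

/-- Since `D` is the intersection of its localizations at height-one primes, the order of divisors
detects divisibility of elements. -/
theorem dvd_of_elementDivisor_le {a b : D} (ha : a ≠ 0) (hb : b ≠ 0)
    (h : elementDivisor a ha ≤ elementDivisor b hb) : a ∣ b := by
  have ha' : algebraMap D (FractionRing D) a ≠ 0 := by simpa using ha
  have hmem : algebraMap D (FractionRing D) b * (algebraMap D (FractionRing D) a)⁻¹ ∈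
      (⨅ q : HeightOnePrime D, Localization.subalgebra.ofField (FractionRing D) _
        q.1.asIdeal.primeCompl_le_nonZeroDivisors) := by
    rw [Algebra.mem_iInf]
    intro q
    have hq : ordAt q a ≤ ordAt q b := Nat.cast_le.mp (h q)
    have hdvd : algebraMap D (Localization.AtPrime q.1.asIdeal) a ∣
        algebraMap D (Localization.AtPrime q.1.asIdeal) b := by
      rw [← IsDiscreteValuationRing.addVal_le_iff_dvd,
        ← ENat.natCast_toNat (addVal_algebraMap_ne_top q ha),
        ← ENat.natCast_toNat (addVal_algebraMap_ne_top q hb)]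
      exact_mod_cast hq
    obtain ⟨c, hc⟩ := hdvd
    obtain ⟨x, t, rfl⟩ := IsLocalization.exists_mk'_eq q.1.asIdeal.primeCompl c
    have hxt : b * t = a * x := by
      apply IsLocalization.injective (Localization.AtPrime q.1.asIdeal)
        q.1.asIdeal.primeCompl_le_nonZeroDivisors
      rw [map_mul, map_mul, hc, mul_assoc, IsLocalization.mk'_spec]
    have ht : algebraMap D (FractionRing D) t ≠ 0 := by
      have : (t : D) ≠ 0 := fun h0 => t.2 (h0 ▸ zero_mem _)
      simpa using this
    refine ⟨x, t, t.2, ?_⟩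
    have := congrArg (algebraMap D (FractionRing D)) hxt
    rw [map_mul, map_mul] at this
    field_simp
    rw [this, mul_comm]
  rw [IsKrullDomain.iInf_localization_eq_bot, Algebra.mem_bot] at hmem
  obtain ⟨c, hc⟩ := hmem
  refine ⟨c, IsFractionRing.injective D (FractionRing D) ?_⟩
  rw [map_mul, hc]
  field_simp

theorem elementDivisor_le_of_dvd {a b : D} (ha : a ≠ 0) (hb : b ≠ 0) (h : a ∣ b) :
    elementDivisor a ha ≤ elementDivisor b hb := by
  obtain ⟨c, rfl⟩ := h
  rw [elementDivisor_mul ha (right_ne_zero_of_mul hb)]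
  exact le_add_of_nonneg_right (elementDivisor_nonneg _ _)

theorem isUnit_of_elementDivisor_eq_zero {a : D} (ha : a ≠ 0) (h : elementDivisor a ha = 0) :
    IsUnit a :=
  isUnit_of_dvd_one <| dvd_of_elementDivisor_le ha one_ne_zero (by rw [h, elementDivisor_one])

theorem elementDivisor_mem_principalDivisors {a : D} (ha : a ≠ 0) :
    elementDivisor a ha ∈ principalDivisors D :=
  AddSubgroup.subset_closure ⟨a, ha, rfl⟩

/-- Every effective principal divisor is the divisor of an element of `D`, not just of a fraction:
if `div a - div b` is effective, then `b ∣ a`. -/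
theorem exists_elementDivisor_eq {d : KrullDivisor D} (hd : d ∈ principalDivisors D)
    (h0 : 0 ≤ d) : ∃ (a : D) (ha : a ≠ 0), elementDivisor a ha = d := by
  have hsub : ∃ (a b : D) (ha : a ≠ 0) (hb : b ≠ 0),
      d = elementDivisor a ha - elementDivisor b hb := by
    clear h0
    induction hd using AddSubgroup.closure_induction with
    | mem x hx =>
      obtain ⟨a, ha, rfl⟩ := hx
      exact ⟨a, 1, ha, one_ne_zero, by rw [elementDivisor_one, sub_zero]⟩
    | zero => exact ⟨1, 1, one_ne_zero, one_ne_zero, by rw [sub_self]⟩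
    | add x y _ _ hx hy =>
      obtain ⟨a, b, ha, hb, rfl⟩ := hx
      obtain ⟨a', b', ha', hb', rfl⟩ := hy
      refine ⟨a * a', b * b', mul_ne_zero ha ha', mul_ne_zero hb hb', ?_⟩
      rw [elementDivisor_mul ha ha', elementDivisor_mul hb hb']
      abel
    | neg x _ hx =>
      obtain ⟨a, b, ha, hb, rfl⟩ := hx
      exact ⟨b, a, hb, ha, neg_sub _ _⟩
  obtain ⟨a, b, ha, hb, rfl⟩ := hsub
  obtain ⟨c, rfl⟩ := dvd_of_elementDivisor_le hb ha (sub_nonneg.mp h0)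
  have hc := right_ne_zero_of_mul ha
  exact ⟨c, hc, by rw [elementDivisor_mul hb hc, add_sub_cancel_left]⟩

end Divisors

/-! ### Weights and factorizations when principality is a congruence -/

section Principal

variable {D : Type*} [CommRing D] [IsDomain D] [IsKrullDomain D] {s : HeightOnePrime D → ℤ} {n : ℤ}

theorem dvd_linearCombination_elementDivisor
    (hprin : ∀ d, d ∈ principalDivisors D ↔ n ∣ Finsupp.linearCombination ℤ s d)
    {a : D} (ha : a ≠ 0) : n ∣ Finsupp.linearCombination ℤ s (elementDivisor a ha) :=
  (hprin _).mp (elementDivisor_mem_principalDivisors ha)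

theorem linearCombination_elementDivisor_pos (hs : ∀ q, 0 < s q) {a : D} (ha : a ≠ 0)
    (hu : ¬ IsUnit a) : 0 < Finsupp.linearCombination ℤ s (elementDivisor a ha) := by
  refine lt_of_le_of_ne (linearCombination_nonneg_of_pos hs (elementDivisor_nonneg a ha))
    fun h => hu (isUnit_of_elementDivisor_eq_zero ha ?_)
  exact (eq_of_le_of_linearCombination_eq hs (elementDivisor_nonneg a ha)
    (by rw [map_zero, h])).symm

theorem irreducible_of_linearCombination_eq (hs : ∀ q, 0 < s q) (hn : 0 < n)
    (hprin : ∀ d, d ∈ principalDivisors D ↔ n ∣ Finsupp.linearCombination ℤ s d)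
    {a : D} (ha : a ≠ 0) (hw : Finsupp.linearCombination ℤ s (elementDivisor a ha) = n) :
    Irreducible a := by
  refine ⟨fun hu => ?_, fun {b c} hbc => ?_⟩
  · have h := linearCombination_le_of_pos hs
      (elementDivisor_le_of_dvd ha one_ne_zero hu.dvd)
    rw [elementDivisor_one, map_zero] at h
    linarith
  · subst hbc
    have hb := left_ne_zero_of_mul ha
    have hc := right_ne_zero_of_mul ha
    by_contra! h
    have h1 := Int.le_of_dvd (linearCombination_elementDivisor_pos hs hb h.1)
      (dvd_linearCombination_elementDivisor hprin hb)
    have h2 := Int.le_of_dvd (linearCombination_elementDivisor_pos hs hc h.2)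
      (dvd_linearCombination_elementDivisor hprin hc)
    rw [elementDivisor_mul hb hc, map_add] at hw
    linarith

/-- Under the chain and divisibility conditions the atoms are exactly the elements of weight `n`:
an atom of larger weight would have an element of weight `n` as a proper divisor. -/
theorem linearCombination_eq_of_irreducible (hs : ∀ q, 0 < s q)
    (hchain : ∀ q r, s q ∣ s r ∨ s r ∣ s q) (hn : 0 < n) (hdvd : ∀ q, s q ∣ n)
    (hprin : ∀ d, d ∈ principalDivisors D ↔ n ∣ Finsupp.linearCombination ℤ s d)
    {a : D} (ha : a ≠ 0) (hirr : Irreducible a) :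
    Finsupp.linearCombination ℤ s (elementDivisor a ha) = n := by
  have hle := Int.le_of_dvd (linearCombination_elementDivisor_pos hs ha hirr.not_isUnit)
    (dvd_linearCombination_elementDivisor hprin ha)
  obtain ⟨U, hU0, hU, hUn⟩ := exists_le_linearCombination_eq hs hchain hn hdvd
    (elementDivisor_nonneg a ha) hle
  obtain ⟨u, hu, rfl⟩ := exists_elementDivisor_eq ((hprin U).mpr (by rw [hUn])) hU0
  have hirru := irreducible_of_linearCombination_eq hs hn hprin hu hUn
  have hassoc := hirru.associated_of_dvd hirr (dvd_of_elementDivisor_le hu ha hU)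
  rw [le_antisymm (elementDivisor_le_of_dvd ha hu hassoc.symm.dvd) hU, hUn]

/-- Half-factoriality forces the weight of a prime `q` to divide `n`, in the presence of a prime
`p` of weight one. Take `a, b, c` with divisors `q + (n - s q) p`, `n p` and `m q`, where `m` is
the order of `s q` modulo `n`. These are irreducible and `a ^ m = b ^ e * c` with
`e * n = m * (n - s q)`, so `m = e + 1`, that is `m * s q = n`. -/
theorem dvd_of_isHFD (hHFD : IsHFD D) (hs : ∀ q, 0 < s q) (hsn : ∀ q, s q ≤ n) (hn : 0 < n)
    (hprin : ∀ d, d ∈ principalDivisors D ↔ n ∣ Finsupp.linearCombination ℤ s d)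
    {p : HeightOnePrime D} (hp : s p = 1) (q : HeightOnePrime D) : s q ∣ n := by
  classical
  have hex : ∃ m : ℕ, 0 < m ∧ n ∣ m * s q :=
    ⟨n.toNat, by omega, by rw [Int.toNat_of_nonneg hn.le]; exact dvd_mul_right _ _⟩
  set m := Nat.find hex
  obtain ⟨hm0, e', he'⟩ : 0 < m ∧ n ∣ m * s q := Nat.find_spec hex
  have hmin : ∀ k : ℕ, 0 < k → n ∣ k * s q → m ≤ k := fun k h1 h2 => Nat.find_min' hex ⟨h1, h2⟩
  have hsq := hs q
  have hsqn := hsn q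
  have hm0' : (0 : ℤ) < m := by exact_mod_cast hm0
  have hen : ((m : ℤ) - e') * n = m * (n - s q) := by linear_combination he'
  obtain ⟨e, he⟩ : ∃ e : ℕ, (m : ℤ) - e' = e := by
    refine Int.eq_ofNat_of_zero_le ?_
    by_contra h
    nlinarith [mul_nonneg hm0'.le (sub_nonneg.mpr hsqn)]
  rw [he] at hen
  have hwa : Finsupp.linearCombination ℤ s
      (Finsupp.single q 1 + (n - s q) • Finsupp.single p 1) = n := by
    rw [map_add, map_zsmul, Finsupp.linearCombination_single, Finsupp.linearCombination_single, hp]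
    simp
  have hwb : Finsupp.linearCombination ℤ s (n • Finsupp.single p 1) = n := by
    rw [map_zsmul, Finsupp.linearCombination_single, hp]
    simp
  have hp0 : (0 : KrullDivisor D) ≤ Finsupp.single p 1 := Finsupp.single_nonneg.mpr zero_le_one
  have hq0 : (0 : KrullDivisor D) ≤ Finsupp.single q 1 := Finsupp.single_nonneg.mpr zero_le_one
  obtain ⟨a, ha, hda⟩ := exists_elementDivisor_eq ((hprin _).mpr (by rw [hwa]))
    (add_nonneg hq0 (zsmul_nonneg hp0 (sub_nonneg.mpr hsqn)))
  obtain ⟨b, hb, hdb⟩ := exists_elementDivisor_eq ((hprin _).mpr (by rw [hwb]))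
    (zsmul_nonneg hp0 hn.le)
  have hairr := irreducible_of_linearCombination_eq hs hn hprin ha (hda ▸ hwa)
  have hbirr := irreducible_of_linearCombination_eq hs hn hprin hb (hdb ▸ hwb)
  have hpow : elementDivisor (a ^ m) (pow_ne_zero m ha) =
      elementDivisor (b ^ e) (pow_ne_zero e hb) + m • Finsupp.single q 1 := by
    rw [elementDivisor_pow ha, elementDivisor_pow hb, hda, hdb, smul_add, ← natCast_zsmul,
      ← natCast_zsmul, ← natCast_zsmul, smul_smul, smul_smul, hen, add_comm]
  obtain ⟨c, hc⟩ := dvd_of_elementDivisor_le (pow_ne_zero e hb) (pow_ne_zero m ha)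
    (hpow ▸ le_add_of_nonneg_right (nsmul_nonneg hq0 m))
  have hc0 : c ≠ 0 := right_ne_zero_of_mul (hc ▸ pow_ne_zero m ha)
  have hdc : elementDivisor c hc0 = m • Finsupp.single q 1 := by
    simp only [hc, elementDivisor_mul (pow_ne_zero e hb) hc0] at hpow
    exact add_left_cancel hpow
  have hcirr : Irreducible c := by
    have hwc : 0 < Finsupp.linearCombination ℤ s (elementDivisor c hc0) := by
      rw [hdc, map_nsmul, Finsupp.linearCombination_single, one_smul]
      exact nsmul_pos hsq hm0.ne'
    -- A nonunit factor of `c` has divisor `k q` with `k > 0` and `n ∣ k * s q`, so `m ≤ k`.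
    have key : ∀ {x : D} (hx : x ≠ 0), x ∣ c → ¬ IsUnit x → m ≤ ordAt q x := by
      intro x hx hxc hxu
      have hle := elementDivisor_le_of_dvd hx hc0 hxc
      have hdx : elementDivisor x hx = Finsupp.single q (ordAt q x : ℤ) := by
        ext r
        rcases eq_or_ne r q with rfl | hr
        · simp [elementDivisor_apply]
        · have h1 := hle r
          rw [hdc, Finsupp.smul_apply, Finsupp.single_eq_of_ne hr, smul_zero] at h1
          rw [Finsupp.single_eq_of_ne hr]
          exact le_antisymm h1 (elementDivisor_nonneg x hx r)
      have h1 := linearCombination_elementDivisor_pos hs hx hxu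
      have h2 := dvd_linearCombination_elementDivisor hprin hx
      rw [hdx, Finsupp.linearCombination_single, smul_eq_mul] at h1 h2
      refine hmin _ (Nat.pos_of_ne_zero fun h0 => ?_) h2
      simp [h0] at h1
    refine ⟨fun hu => ?_, fun {x y} hxy => ?_⟩
    · have h := linearCombination_le_of_pos hs (elementDivisor_le_of_dvd hc0 one_ne_zero hu.dvd)
      rw [elementDivisor_one, map_zero] at h
      linarith
    · by_contra! h
      have hx : x ≠ 0 := left_ne_zero_of_mul (hxy ▸ hc0)
      have hy : y ≠ 0 := right_ne_zero_of_mul (hxy ▸ hc0)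
      have h1 := key hx ⟨y, hxy⟩ h.1
      have h2 := key hy ⟨x, by rw [hxy, mul_comm]⟩ h.2
      have h3 : ordAt q c = m := by
        have := DFunLike.congr_fun hdc q
        simpa [elementDivisor_apply] using this
      rw [hxy, ordAt_mul q hx hy] at h3
      omega
  have hcard := hHFD.2 (Multiset.replicate m a) (c ::ₘ Multiset.replicate e b)
    (fun x hx => by rwa [Multiset.eq_of_mem_replicate hx])
    (fun x hx => by
      rcases Multiset.mem_cons.mp hx with rfl | hx
      · exact hcirr
      · rwa [Multiset.eq_of_mem_replicate hx])
    (by rw [Multiset.prod_replicate, Multiset.prod_cons, Multiset.prod_replicate, hc, mul_comm])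
  rw [Multiset.card_replicate, Multiset.card_cons, Multiset.card_replicate] at hcard
  refine ⟨m, ?_⟩
  have hcard' : (m : ℤ) = e + 1 := by exact_mod_cast hcard
  linear_combination -hen - n * hcard'

end Principal

/-! ### The weight given by multiples of a generating prime class -/

section Generator

variable {D : Type*} [CommRing D] [IsDomain D] [IsKrullDomain D]

theorem addOrderOf_primeClass {p : HeightOnePrime D}
    (hp : AddSubgroup.zmultiples (primeClass p) = ⊤) :
    addOrderOf (primeClass p) = Nat.card (DivisorClassGroup D) :=
  addOrderOf_eq_card_of_zmultiples_eq_top hp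

theorem exists_mem_Icc_zsmul_primeClass_eq [Finite (DivisorClassGroup D)] {p : HeightOnePrime D}
    (hp : AddSubgroup.zmultiples (primeClass p) = ⊤) (x : DivisorClassGroup D) :
    ∃ t : ℤ, 1 ≤ t ∧ t ≤ (Nat.card (DivisorClassGroup D) : ℤ) ∧ t • primeClass p = x := by
  have hx : x ∈ AddSubgroup.zmultiples (primeClass p) := hp ▸ AddSubgroup.mem_top x
  obtain ⟨k, hk⟩ := hx
  have hn : (0 : ℤ) < Nat.card (DivisorClassGroup D) := by exact_mod_cast Nat.card_pos
  -- Representatives of residues in `[1, n]` rather than `[0, n - 1]`.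
  refine ⟨(k - 1) % Nat.card (DivisorClassGroup D) + 1, ?_, ?_, ?_⟩
  · linarith [Int.emod_nonneg (k - 1) hn.ne']
  · linarith [Int.emod_lt_of_pos (k - 1) hn]
  · rw [← hk, ← addOrderOf_primeClass hp, add_zsmul, mod_addOrderOf_zsmul, ← add_zsmul,
      sub_add_cancel]

theorem mem_principalDivisors_iff_dvd_linearCombination {p : HeightOnePrime D}
    (hp : AddSubgroup.zmultiples (primeClass p) = ⊤) {s : HeightOnePrime D → ℤ}
    (hs : ∀ q, s q • primeClass p = primeClass q) (d : KrullDivisor D) :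
    d ∈ principalDivisors D ↔
      (Nat.card (DivisorClassGroup D) : ℤ) ∣ Finsupp.linearCombination ℤ s d := by
  have hclass : ∀ d : KrullDivisor D,
      (QuotientAddGroup.mk d : DivisorClassGroup D) =
        Finsupp.linearCombination ℤ s d • primeClass p := by
    intro d
    induction d using Finsupp.induction_linear with
    | zero => simp
    | add x y hx hy => rw [QuotientAddGroup.mk_add, hx, hy, map_add, add_zsmul]
    | single q k =>
      rw [Finsupp.linearCombination_single, smul_assoc, hs, primeClass, ← QuotientAddGroup.mk_zsmul]
      simp
  rw [← QuotientAddGroup.eq_zero_iff, hclass, ← addOrderOf_primeClass hp,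
    addOrderOf_dvd_iff_zsmul_eq_zero]

end Generator

/-! ### The irreducible divisor pair property -/

theorem theorem3p13 {D : Type*} [CommRing D] [IsDomain D] [IsKrullDomain D]
    (hfin : Finite (DivisorClassGroup D))
    (p : HeightOnePrime D)
    (hp : AddSubgroup.zmultiples (primeClass p) = ⊤)
    (hS : ∀ s ∈ primeClassExponents p, ∀ t ∈ primeClassExponents p, s ∣ t ∨ t ∣ s)
    (hHFD : IsHFD D) :
    IsIDPD D := by
  have hn : (0 : ℤ) < Nat.card (DivisorClassGroup D) := by exact_mod_cast Nat.card_pos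
  choose s hs1 hsn hsq using fun q : HeightOnePrime D =>
    exists_mem_Icc_zsmul_primeClass_eq hp (primeClass q)
  have hs : ∀ q, 0 < s q := hs1
  have hchain : ∀ q r, s q ∣ s r ∨ s r ∣ s q := fun q r =>
    hS _ ⟨hs1 q, hsn q, q, hsq q⟩ _ ⟨hs1 r, hsn r, r, hsq r⟩
  have hprin := mem_principalDivisors_iff_dvd_linearCombination hp hsq
  -- `s p` is congruent to `1` modulo the class number and lies in the same range of residues.
  have hsp : s p = 1 := by
    have h : (s p - 1) • primeClass p = 0 := by rw [sub_smul, hsq p, one_smul, sub_self]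
    rw [← addOrderOf_dvd_iff_zsmul_eq_zero, addOrderOf_primeClass hp] at h
    have := Int.eq_zero_of_dvd_of_nonneg_of_lt (by linarith [hs1 p]) (by linarith [hsn p]) h
    linarith
  have hdvd := dvd_of_isHFD hHFD hs hsn hn hprin hsp
  refine ⟨hHFD.1, fun z hz _ a b ha hb haz hbz hab => ?_⟩
  have hwa := linearCombination_eq_of_irreducible hs hchain hn hdvd hprin ha.ne_zero ha
  have hwb := linearCombination_eq_of_irreducible hs hchain hn hdvd hprin hb.ne_zero hb
  obtain ⟨W, haW, hbW, hWz, hW⟩ := exists_sup_le_linearCombination_eq hs hchain hn hdvd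
    (elementDivisor_nonneg a ha.ne_zero) (elementDivisor_nonneg b hb.ne_zero)
    (elementDivisor_le_of_dvd ha.ne_zero hz haz) (elementDivisor_le_of_dvd hb.ne_zero hz hbz)
    (fun h => hab (associated_of_dvd_dvd (dvd_of_elementDivisor_le _ _ h.le)
      (dvd_of_elementDivisor_le _ _ h.ge)))
    hwa hwb (dvd_linearCombination_elementDivisor hprin hz)
  obtain ⟨y, hy, rfl⟩ := exists_elementDivisor_eq
    ((hprin W).mpr (by rw [hW]; exact dvd_mul_left _ _))
    ((elementDivisor_nonneg a ha.ne_zero).trans haW)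
  obtain ⟨a', ha'⟩ := dvd_of_elementDivisor_le ha.ne_zero hy haW
  obtain ⟨b', hb'⟩ := dvd_of_elementDivisor_le hb.ne_zero hy hbW
  have hirr : ∀ {c c' : D} (hc : c ≠ 0), y = c * c' →
      Finsupp.linearCombination ℤ s (elementDivisor c hc) =
        (Nat.card (DivisorClassGroup D) : ℤ) → Irreducible c' := by
    rintro c c' hc rfl hw
    have hc' := right_ne_zero_of_mul hy
    refine irreducible_of_linearCombination_eq hs hn hprin hc' ?_
    rw [elementDivisor_mul hc hc', map_add, hw] at hW
    linarith
  refine ⟨a', b', hirr ha.ne_zero ha' hwa, hirr hb.ne_zero hb' hwb, ?_, ?_⟩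
  · rw [← ha', ← hb']
  · rw [← hb']
    exact dvd_of_elementDivisor_le hy hz hWz
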